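/- All groups are finite. A class of groups $\mathfrak{F}$ (closed under isomorphism) is a Fitting class if it contains every normal subgroup of each of its members and contains $G$ whenever $G=N_1N_2$ with $N_1,N_2\trianglelefteq G$ and $N_1,N_2\in\mathfrak{F}$; it is $Q$-closed if it contains every quotient of each of its members. Let $\mathfrak{F}$ be a $Q$-closed Fitting class all of whose members are soluble. For a group $G$ let $\gamma(G)$ be the $\mathfrak{F}$-radical of $G$, that is, the product of all normal subgroups of $G$ that belong to $\mathfrak{F}$. Put $\gamma_{(0)}(G)=1$ and define $\gamma_{(i+1)}(G)$ by $\gamma_{(i+1)}(G)/\gamma_{(i)}(G)=\gamma\bigl(G/\gamma_{(i)}(G)\bigr)$. Let the $\gamma$-length $h_\gamma(G)$ be the least $h$ with $\gamma_{(h)}(G)=G$, and $h_\gamma(G)=\infty$ if there is no such $h$. Let $\pi=\pi(\mathfrak{F})$ be the set of all primes that divide the order of some member of $\mathfrak{F}$. If $M$ is a maximal subgroup of a soluble $\pi$-group $G$ (a group all prime divisors of whose order lie in $\pi$), then $h_\gamma(G)$ and $h_\gamma(M)$ are finite and $$h_\gamma(G)-h_\gamma(M)\leq 2.$$ -/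

import Mathlib

universe u

/-- A class of finite groups: a collection of finite groups closed under isomorphism. -/
structure GroupClass where
  /-- Membership of a finite group in the class. -/
  Mem : (G : Type u) → [Group G] → [Finite G] → Prop
  mem_of_mulEquiv : ∀ {G H : Type u} [Group G] [Finite G] [Group H] [Finite H],
    (G ≃* H) → Mem G → Mem H

namespace GroupClass

/-- A Fitting class: closed under normal subgroups, and under products of two normal subgroups. -/
structure IsFittingClass (𝔉 : GroupClass.{u}) : Prop where
  mem_of_normal : ∀ (G : Type u) [Group G] [Finite G] (N : Subgroup G), N.Normal →
    𝔉.Mem G → 𝔉.Mem N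
  mem_of_sup_eq_top : ∀ (G : Type u) [Group G] [Finite G] (N₁ N₂ : Subgroup G),
    N₁.Normal → N₂.Normal → N₁ ⊔ N₂ = ⊤ → 𝔉.Mem N₁ → 𝔉.Mem N₂ → 𝔉.Mem G

/-- A `Q`-closed class: closed under quotient groups. -/
def IsQClosed (𝔉 : GroupClass.{u}) : Prop :=
  ∀ (G : Type u) [Group G] [Finite G] (N : Subgroup G) [N.Normal], 𝔉.Mem G → 𝔉.Mem (G ⧸ N)

/-- All groups in the class are soluble. -/
def IsSoluble (𝔉 : GroupClass.{u}) : Prop :=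
  ∀ (G : Type u) [Group G] [Finite G], 𝔉.Mem G → Group.IsSolvable G

/-- `π(𝔉)`: the set of all primes that divide the order of some group in the class. -/
def primes (𝔉 : GroupClass.{u}) : Set ℕ :=
  {p | p.Prime ∧ ∃ (G : Type u) (_ : Group G) (_ : Finite G), 𝔉.Mem G ∧ p ∣ Nat.card G}

end GroupClass

/-- A finite group is a `π`-group if all prime divisors of its order belong to `π`. -/
def IsPiGroup (π : Set ℕ) (G : Type u) [Group G] [Finite G] : Prop :=
  ∀ p : ℕ, p.Prime → p ∣ Nat.card G → p ∈ π

/-- A functorial assigns to each finite group a subgroup, compatibly with isomorphisms. -/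
structure Functorial where
  /-- The subgroup assigned to a finite group. -/
  sub : (G : Type u) → [Group G] → [Finite G] → Subgroup G
  map_sub : ∀ {G H : Type u} [Group G] [Finite G] [Group H] [Finite H] (f : G ≃* H),
    (sub G).map f.toMonoidHom = sub H

namespace Functorial

instance normal_sub (γ : Functorial.{u}) (G : Type u) [Group G] [Finite G] :
    (γ.sub G).Normal := by
  refine ⟨fun n hn g => ?_⟩
  have h := γ.map_sub (MulAut.conj g : G ≃* G)
  rw [← h]
  exact ⟨n, hn, by simp⟩

/-- The trivial functorial `G ↦ 1`. -/
def triv : Functorial.{u} where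
  sub _ _ _ := ⊥
  map_sub _ := Subgroup.map_bot _

/-- The upper product `γ₂ ⋆ γ₁`: the subgroup `(γ₂ ⋆ γ₁)(G)` contains `γ₂(G)`, and
`(γ₂ ⋆ γ₁)(G) / γ₂(G) = γ₁(G / γ₂(G))`. -/
def upperProduct (γ₂ γ₁ : Functorial.{u}) : Functorial.{u} where
  sub G _ _ := (γ₁.sub (G ⧸ γ₂.sub G)).comap (QuotientGroup.mk' (γ₂.sub G))
  map_sub {G H} _ _ _ _ f := by
    have h := γ₁.map_sub (QuotientGroup.congr (γ₂.sub G) (γ₂.sub H) f (γ₂.map_sub f))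
    ext y
    obtain ⟨x, rfl⟩ := f.surjective y
    rw [Subgroup.mem_comap, ← h]
    constructor
    · rintro ⟨z, hz, hzx⟩
      obtain rfl : z = x := f.injective hzx
      exact ⟨_, hz, rfl⟩
    · rintro ⟨z, hz, hzx⟩
      refine ⟨x, ?_, rfl⟩
      have h2 : z = QuotientGroup.mk' (γ₂.sub G) x :=
        (QuotientGroup.congr (γ₂.sub G) (γ₂.sub H) f (γ₂.map_sub f)).injective hzx
      rw [h2] at hz
      exact hz

/-- The terms `γ₍ᵢ₎` of the `γ`-series. -/
def series (γ : Functorial.{u}) : ℕ → Functorial.{u}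
  | 0 => triv
  | i + 1 => (γ.series i).upperProduct γ

/-- The `γ`-length of `G`: the least `h` with `γ₍ₕ₎(G) = G`, and `⊤` if there is none. -/
noncomputable def length (γ : Functorial.{u}) (G : Type u) [Group G] [Finite G] : ℕ∞ :=
  sInf ((fun h : ℕ => (h : ℕ∞)) '' {h : ℕ | (γ.series h).sub G = ⊤})

end Functorial

/-- The functorial that assigns to each group its `𝔉`-radical: the product of all normal subgroups
that belong to the class `𝔉`. -/
def GroupClass.radical (𝔉 : GroupClass.{u}) : Functorial.{u} where
  sub G _ _ := sSup {N : Subgroup G | N.Normal ∧ 𝔉.Mem N}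
  map_sub {G H} _ _ _ _ f := by
    have key : ∀ {A B : Type u} [Group A] [Finite A] [Group B] [Finite B] (e : A ≃* B),
        (sSup {N : Subgroup A | N.Normal ∧ 𝔉.Mem N}).map e.toMonoidHom ≤
          sSup {N : Subgroup B | N.Normal ∧ 𝔉.Mem N} := by
      intro A B _ _ _ _ e
      rw [Subgroup.map_le_iff_le_comap]
      refine sSup_le fun N hN => ?_
      rw [← Subgroup.map_le_iff_le_comap]
      exact le_sSup ⟨hN.1.map e.toMonoidHom e.surjective,
        𝔉.mem_of_mulEquiv (e.subgroupMap N) hN.2⟩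
    refine le_antisymm (key f) fun y hy => ?_
    exact ⟨f.symm y, key f.symm ⟨y, hy, rfl⟩, f.apply_symm_apply y⟩

open Subgroup
open scoped commutatorElement

/-! ### Radicals of Fitting classes -/

namespace GroupClass

variable {𝔉 : GroupClass.{u}}

/-! All nilpotent `π`-groups lie in `𝔉` (`mem_of_isNilpotent`), so the radical of a soluble
`π`-group contains its centralizer (`centralizer_radical_le`). Hence the series stalls only at `G`,
and the series of `M` and `G` agree at `j` while γ₍ⱼ₊₁₎(G) ≤ M (`map_series_of_series_succ_le`). Let
n be least with γ₍ₙ₊₂₎(G) not inside `M`. Then γ₍ₙ₎(M) ≤ γ₍ₙ₊₂₎(G), and maximality makes the latter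
supplement `M`. From there on the quotients of `G` are quotients of `M`, so by `Q`-closure the
inclusion persists when both indices grow (`map_series_add_le`). Once the left side is `M`, the
right side is `G`. -/

theorem Mem.of_mulEquiv {G H : Type u} [Group G] [Finite G] [Group H] [Finite H]
    (h : 𝔉.Mem G) (e : G ≃* H) : 𝔉.Mem H :=
  𝔉.mem_of_mulEquiv e h

theorem IsQClosed.mem_of_surjective (hQ : 𝔉.IsQClosed) {G H : Type u} [Group G] [Finite G]
    [Group H] [Finite H] (f : G →* H) (hf : Function.Surjective f) (h : 𝔉.Mem G) : 𝔉.Mem H :=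
  (hQ G f.ker h).of_mulEquiv (QuotientGroup.quotientKerEquivOfSurjective f hf)

theorem le_radical {G : Type u} [Group G] [Finite G] {N : Subgroup G} (hN : N.Normal)
    (h : 𝔉.Mem N) : N ≤ 𝔉.radical.sub G :=
  le_sSup ⟨hN, h⟩

theorem IsFittingClass.mem_sup (hF : 𝔉.IsFittingClass) {G : Type u} [Group G] [Finite G]
    {A B : Subgroup G} (hA : A.Normal) (hB : B.Normal) (hA' : 𝔉.Mem A) (hB' : 𝔉.Mem B) :
    𝔉.Mem (A ⊔ B : Subgroup G) := by
  refine hF.mem_of_sup_eq_top _ (A.subgroupOf (A ⊔ B)) (B.subgroupOf (A ⊔ B)) inferInstance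
    inferInstance ?_ (hA'.of_mulEquiv (subgroupOfEquivOfLe le_sup_left).symm)
    (hB'.of_mulEquiv (subgroupOfEquivOfLe le_sup_right).symm)
  rw [← subgroupOf_sup le_sup_left le_sup_right, subgroupOf_self]

theorem IsFittingClass.mem_radical (hF : 𝔉.IsFittingClass) (h1 : 𝔉.Mem PUnit.{u + 1})
    (G : Type u) [Group G] [Finite G] : 𝔉.Mem (𝔉.radical.sub G) := by
  have hfin : {N : Subgroup G | N.Normal ∧ 𝔉.Mem N}.Finite := Set.toFinite _
  have key := Finset.sup_mem {N : Subgroup G | N.Normal ∧ 𝔉.Mem N}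
    ⟨inferInstance, h1.of_mulEquiv (MulEquiv.ofUnique (M := PUnit) (N := (⊥ : Subgroup G)))⟩
    (fun A hA B hB => ⟨@Subgroup.sup_normal _ _ A B hA.1 hB.1, hF.mem_sup hA.1 hB.1 hA.2 hB.2⟩)
    hfin.toFinset id (fun N hN => by simpa using hN)
  rw [Finset.sup_id_eq_sSup, Set.Finite.coe_toFinset] at key
  exact key.2

theorem IsFittingClass.mem_of_radical_eq_top (hF : 𝔉.IsFittingClass) (h1 : 𝔉.Mem PUnit.{u + 1})
    {G : Type u} [Group G] [Finite G] (h : 𝔉.radical.sub G = ⊤) : 𝔉.Mem G :=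
  (hF.mem_radical h1 G).of_mulEquiv ((MulEquiv.subgroupCongr h).trans topEquiv)

theorem IsQClosed.radical_le_comap (hQ : 𝔉.IsQClosed) {G H : Type u} [Group G] [Finite G]
    [Group H] [Finite H] (f : G →* H) (hf : Function.Surjective f) :
    𝔉.radical.sub G ≤ (𝔉.radical.sub H).comap f := by
  refine sSup_le fun N hN => ?_
  rw [← map_le_iff_le_comap]
  exact le_radical (hN.1.map f hf)
    (hQ.mem_of_surjective (f.subgroupMap N) (f.subgroupMap_surjective N) hN.2)

end GroupClass

/-! ### The γ-series -/

namespace Functorial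

variable (γ : Functorial.{u})

instance characteristic_sub (G : Type u) [Group G] [Finite G] : (γ.sub G).Characteristic :=
  characteristic_iff_map_eq.2 fun e => γ.map_sub e

theorem mem_sub_iff {G H : Type u} [Group G] [Finite G] [Group H] [Finite H] (e : G ≃* H)
    {x : G} : e x ∈ γ.sub H ↔ x ∈ γ.sub G := by
  rw [← γ.map_sub e]
  exact mem_map_equiv.trans (by simp)

/-- The inverse image in `G` of `γ(G / K)`. -/
def preimage {G : Type u} [Group G] [Finite G] (K : Subgroup G) [K.Normal] : Subgroup G :=
  (γ.sub (G ⧸ K)).comap (QuotientGroup.mk' K)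

instance normal_preimage {G : Type u} [Group G] [Finite G] (K : Subgroup G) [K.Normal] :
    (γ.preimage K).Normal :=
  normal_comap _

theorem le_preimage {G : Type u} [Group G] [Finite G] (K : Subgroup G) [K.Normal] :
    K ≤ γ.preimage K := fun x hx => by
  have : QuotientGroup.mk' K x = 1 := (QuotientGroup.eq_one_iff x).2 hx
  rw [preimage, mem_comap, this]
  exact one_mem _

theorem preimage_eq_comap {G H : Type u} [Group G] [Finite G] [Group H] [Finite H] (f : G →* H)
    (hf : Function.Surjective f) {K : Subgroup G} [K.Normal] (hK : f.ker = K) :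
    γ.preimage K = (γ.sub H).comap f := by
  subst hK
  ext x
  exact (γ.mem_sub_iff (QuotientGroup.quotientKerEquivOfSurjective f hf)
    (x := QuotientGroup.mk' f.ker x)).symm

theorem series_succ_sub (i : ℕ) (G : Type u) [Group G] [Finite G] :
    (γ.series (i + 1)).sub G = γ.preimage ((γ.series i).sub G) :=
  rfl

theorem series_mono (G : Type u) [Group G] [Finite G] :
    Monotone fun i => (γ.series i).sub G :=
  monotone_nat_of_le_succ fun _ => γ.le_preimage _

theorem length_eq_of_isLeast {G : Type u} [Group G] [Finite G] {n : ℕ}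
    (h : IsLeast {h : ℕ | (γ.series h).sub G = ⊤} n) : γ.length G = n :=
  IsLeast.csInf_eq ⟨⟨n, h.1, rfl⟩, by
    rintro _ ⟨m, hm, rfl⟩
    exact Nat.cast_le.2 (h.2 hm)⟩

end Functorial

namespace GroupClass

variable {𝔉 : GroupClass.{u}}

theorem IsQClosed.preimage_le_comap (hQ : 𝔉.IsQClosed) {G H : Type u} [Group G] [Finite G]
    [Group H] [Finite H] (f : G →* H) (hf : Function.Surjective f) {K : Subgroup G} [K.Normal]
    (hK : K ≤ f.ker) : 𝔉.radical.preimage K ≤ (𝔉.radical.sub H).comap f := fun _ hx =>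
  hQ.radical_le_comap (QuotientGroup.lift K f hK)
    (QuotientGroup.lift_surjective_of_surjective K f hf hK) hx

theorem IsFittingClass.map_radical_of_normal (hF : 𝔉.IsFittingClass)
    (h1 : 𝔉.Mem PUnit.{u + 1}) {G : Type u} [Group G] [Finite G] (N : Subgroup G) [N.Normal] :
    (𝔉.radical.sub N).map N.subtype = N ⊓ 𝔉.radical.sub G := by
  refine le_antisymm (le_inf (map_subtype_le _) (le_radical inferInstance
    ((hF.mem_radical h1 N).of_mulEquiv
      (equivMapOfInjective _ N.subtype N.subtype_injective)))) ?_
  have hP : 𝔉.Mem (N ⊓ 𝔉.radical.sub G : Subgroup G) :=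
    (hF.mem_of_normal _ ((N ⊓ 𝔉.radical.sub G).subgroupOf (𝔉.radical.sub G)) inferInstance
      (hF.mem_radical h1 G)).of_mulEquiv (subgroupOfEquivOfLe inf_le_right)
  have hle : (N ⊓ 𝔉.radical.sub G).subgroupOf N ≤ 𝔉.radical.sub N :=
    le_radical inferInstance (hP.of_mulEquiv (subgroupOfEquivOfLe inf_le_left).symm)
  intro x hx
  exact ⟨⟨x, hx.1⟩, hle hx, rfl⟩

/-! ### Nilpotent `π`-groups -/

/-- Subgroups of a nilpotent group are subnormal: descend through normal maximal subgroups. -/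
theorem IsFittingClass.le_radical_of_isNilpotent (hF : 𝔉.IsFittingClass)
    (h1 : 𝔉.Mem PUnit.{u + 1}) {W : Type u} [Group W] [Finite W] [Group.IsNilpotent W]
    {H : Subgroup W} (hH : 𝔉.Mem H) : H ≤ 𝔉.radical.sub W := by
  induction hn : Nat.card W using Nat.strong_induction_on generalizing W with
  | _ n ih =>
    obtain rfl | ⟨N, hN, hHN⟩ := eq_top_or_exists_le_coatom H
    · exact le_radical inferInstance hH
    · have := Group.normalizerCondition_of_isNilpotent (G := W) |>.normal_of_coatom N hN
      have hlt : Nat.card N < n := by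
        rw [← hn]
        exact lt_of_le_of_ne N.card_le_card_group fun h => hN.1 (N.eq_top_of_card_eq h)
      have h2 := ih _ hlt (hH.of_mulEquiv (subgroupOfEquivOfLe hHN).symm) rfl
      intro x hx
      have h3 : x ∈ (𝔉.radical.sub N).map N.subtype := ⟨⟨x, hHN hx⟩, h2 hx, rfl⟩
      rw [hF.map_radical_of_normal h1] at h3
      exact h3.2

theorem IsFittingClass.mem_subgroup_of_isNilpotent (hF : 𝔉.IsFittingClass)
    {W : Type u} [Group W] [Finite W] [Group.IsNilpotent W] (hW : 𝔉.Mem W)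
    (H : Subgroup W) : 𝔉.Mem H := by
  induction hn : Nat.card W using Nat.strong_induction_on generalizing W with
  | _ n ih =>
    obtain rfl | ⟨N, hN, hHN⟩ := eq_top_or_exists_le_coatom H
    · exact hW.of_mulEquiv topEquiv.symm
    · have := Group.normalizerCondition_of_isNilpotent (G := W) |>.normal_of_coatom N hN
      have hlt : Nat.card N < n := by
        rw [← hn]
        exact lt_of_le_of_ne N.card_le_card_group fun h => hN.1 (N.eq_top_of_card_eq h)
      exact (ih _ hlt (hF.mem_of_normal W N this hW) (H.subgroupOf N) rfl).of_mulEquiv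
        (subgroupOfEquivOfLe hHN)

theorem mem_punit_of_mem (hQ : 𝔉.IsQClosed) {G : Type u} [Group G] [Finite G] (h : 𝔉.Mem G) :
    𝔉.Mem PUnit.{u + 1} :=
  hQ.mem_of_surjective 1 (fun _ => ⟨1, rfl⟩) h

/-- By solubility, pass to derived subgroups until p divides the order of the abelianization, where
every subgroup is normal. -/
theorem exists_mem_card_eq_prime (hF : 𝔉.IsFittingClass) (hQ : 𝔉.IsQClosed)
    (hS : 𝔉.IsSoluble) {p : ℕ} (hp : p ∈ 𝔉.primes) :
    ∃ (Z : Type u) (_ : Group Z) (_ : Finite Z), 𝔉.Mem Z ∧ Nat.card Z = p := by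
  obtain ⟨hp, H, _, _, hH, hpH⟩ := hp
  have : Fact p.Prime := ⟨hp⟩
  induction hn : Nat.card H using Nat.strong_induction_on generalizing H with
  | _ n ih =>
    have := hS H hH
    have hnt : Nontrivial H := by
      rw [← Finite.one_lt_card_iff_nontrivial]
      exact hp.one_lt.trans_le (Nat.le_of_dvd Nat.card_pos hpH)
    by_cases hd : p ∣ Nat.card (commutator H)
    · refine ih _ ?_ (commutator H) _ _ (hF.mem_of_normal _ _ inferInstance hH) hd rfl
      rw [← hn]
      exact lt_of_le_of_ne (commutator H).card_le_card_group fun h =>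
        (Group.IsSolvable.commutator_lt_top_of_nontrivial H).ne ((commutator H).eq_top_of_card_eq h)
    · rw [(commutator H).card_eq_card_quotient_mul_card_subgroup] at hpH
      obtain ⟨x, hx⟩ := exists_prime_orderOf_dvd_card' (G := Abelianization H) p
        ((hp.dvd_mul.1 hpH).resolve_right hd)
      exact ⟨zpowers x, inferInstance, inferInstance,
        hF.mem_of_normal _ _ inferInstance (hQ H (commutator H) hH), by rw [Nat.card_zpowers, hx]⟩

end GroupClass

theorem RegularWreathProduct.closure_pow_eq_one {D Q : Type*} [Group D] [Group Q] [Finite Q]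
    {p : ℕ} (hQ : ∀ q : Q, q ^ p = 1) (hD : closure {d : D | d ^ p = 1} = ⊤) :
    closure {w : D ≀ᵣ Q | w ^ p = 1} = ⊤ := by
  classical
  let i : (Q → D) →* D ≀ᵣ Q :=
    { toFun := fun f => ⟨f, 1⟩
      map_one' := rfl
      map_mul' := fun f g => by ext <;> simp }
  have hi (f : Q → D) : i f ∈ closure {w : D ≀ᵣ Q | w ^ p = 1} := by
    refine pi_mem_of_mulSingle_mem (H := (closure {w : D ≀ᵣ Q | w ^ p = 1}).comap i) f fun q => ?_
    have h : closure {d : D | d ^ p = 1} ≤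
        ((closure {w : D ≀ᵣ Q | w ^ p = 1}).comap i).comap (MonoidHom.mulSingle (fun _ => D) q) := by
      rw [closure_le]
      intro d hd
      refine subset_closure ?_
      have hd' : d ^ p = 1 := hd
      rw [Set.mem_ofPred_eq, ← map_pow, ← map_pow, hd', map_one, map_one]
    rw [hD] at h
    exact h (mem_top (f q))
  refine eq_top_iff.2 fun w _ => ?_
  have hw : w = i w.left * RegularWreathProduct.inl w.right := by ext <;> simp [i]
  rw [hw]
  refine mul_mem (hi _) (subset_closure ?_)
  rw [Set.mem_ofPred_eq, ← map_pow, hQ, map_one]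

theorem IteratedWreathProduct.closure_pow_eq_one {Z : Type*} [Group Z] [Finite Z]
    {p : ℕ} (hZ : ∀ z : Z, z ^ p = 1) (n : ℕ) :
    closure {w : IteratedWreathProduct Z n | w ^ p = 1} = ⊤ := by
  induction n with
  | zero =>
    have : Subsingleton (IteratedWreathProduct Z 0) := inferInstanceAs (Subsingleton PUnit)
    exact Subsingleton.elim _ _
  | succ n ih => exact RegularWreathProduct.closure_pow_eq_one hZ ih

namespace GroupClass

variable {𝔉 : GroupClass.{u}}

/-- The iterated wreath product of `Z` is generated by subgroups of order p, all inside its radical.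
It is a Sylow p-subgroup of Sym(P), so by Cayley it contains a copy of `P`, which is subnormal. -/
theorem mem_of_isPGroup (hF : 𝔉.IsFittingClass) (hQ : 𝔉.IsQClosed)
    (hS : 𝔉.IsSoluble) {p : ℕ} (hp : p ∈ 𝔉.primes) {P : Type u} [Group P] [Finite P]
    (hP : IsPGroup p P) : 𝔉.Mem P := by
  obtain ⟨Z, _, _, hZ, hZp⟩ := exists_mem_card_eq_prime hF hQ hS hp
  have h1 := mem_punit_of_mem hQ hZ
  have : Fact p.Prime := ⟨hp.1⟩
  obtain ⟨n, hn⟩ := IsPGroup.iff_card.1 hP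
  have hW : 𝔉.Mem (IteratedWreathProduct Z n) := by
    have hpW : IsPGroup p (IteratedWreathProduct Z n) := IsPGroup.of_card (by
      rw [IteratedWreathProduct.card, hZp])
    have := hpW.isNilpotent
    refine hF.mem_of_radical_eq_top h1 (eq_top_iff.2 ?_)
    rw [← IteratedWreathProduct.closure_pow_eq_one (fun z => hZp ▸ pow_card_eq_one') n,
      closure_le]
    intro w hw
    by_cases hw1 : w = 1
    · rw [hw1]; exact one_mem _
    refine hF.le_radical_of_isNilpotent h1 (H := zpowers w) ?_ (mem_zpowers w)
    exact hZ.of_mulEquiv (mulEquivOfPrimeCardEq hZp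
      (by rw [Nat.card_zpowers, orderOf_eq_prime hw hw1]))
  let f := MulAction.toPermHom P P
  have hf : Function.Injective f := MulAction.toPerm_injective
  obtain ⟨S, hS'⟩ := (hP.of_equiv (MonoidHom.ofInjective hf)).exists_le_sylow
  have hSm : 𝔉.Mem S :=
    hW.of_mulEquiv (Sylow.mulEquivIteratedWreathProduct p n P hn Z hZp S).symm
  have := S.isPGroup'.isNilpotent
  exact ((hF.mem_subgroup_of_isNilpotent hSm (f.range.subgroupOf S)).of_mulEquiv
    (subgroupOfEquivOfLe hS')).of_mulEquiv (MonoidHom.ofInjective hf).symm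

theorem mem_of_isNilpotent (hF : 𝔉.IsFittingClass) (hQ : 𝔉.IsQClosed)
    (hS : 𝔉.IsSoluble) (h1 : 𝔉.Mem PUnit.{u + 1}) {N : Type u} [Group N] [Finite N]
    [Group.IsNilpotent N] (hN : IsPiGroup 𝔉.primes N) : 𝔉.Mem N := by
  refine hF.mem_of_radical_eq_top h1 (index_eq_one.1 ?_)
  by_contra hne
  obtain ⟨p, hp, hpi⟩ := Nat.exists_prime_and_dvd hne
  have : Fact p.Prime := ⟨hp⟩
  have hpp := hN p hp (hpi.trans (index_dvd_card _))
  obtain ⟨P⟩ := (inferInstance : Nonempty (Sylow p N))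
  exact P.not_dvd_index (hpi.trans (index_dvd_of_le (hF.le_radical_of_isNilpotent h1
    (mem_of_isPGroup hF hQ hS hpp P.isPGroup'))))

end GroupClass

theorem IsPiGroup.of_card_dvd {π : Set ℕ} {G H : Type u} [Group G] [Finite G] [Group H] [Finite H]
    (hG : IsPiGroup π G) (h : Nat.card H ∣ Nat.card G) : IsPiGroup π H := fun p hp hpH =>
  hG p hp (hpH.trans h)

/-! ### Comparing the series of `G` and `M` -/

namespace GroupClass

variable {𝔉 : GroupClass.{u}}

theorem centralizer_radical_le (hF : 𝔉.IsFittingClass) (hQ : 𝔉.IsQClosed)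
    (hS : 𝔉.IsSoluble) (h1 : 𝔉.Mem PUnit.{u + 1}) {G : Type u} [Group G] [Finite G]
    [hG : Group.IsSolvable G] (hπ : IsPiGroup 𝔉.primes G) :
    centralizer (𝔉.radical.sub G : Set G) ≤ 𝔉.radical.sub G := by
  set C := centralizer (𝔉.radical.sub G : Set G)
  obtain ⟨n, hn⟩ := hG.solvable
  have step (k : ℕ) (hk : C ⊓ derivedSeries G (k + 1) ≤ 𝔉.radical.sub G) :
      C ⊓ derivedSeries G k ≤ 𝔉.radical.sub G := by
    set D := C ⊓ derivedSeries G k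
    have hDD : ⁅D, D⁆ ≤ 𝔉.radical.sub G :=
      (le_inf ((commutator_le_self D).trans inf_le_left)
        (commutator_mono inf_le_right inf_le_right)).trans hk
    have : D.Normal := inferInstance
    -- `D` centralizes the radical, which contains D′; so D′ is central in `D`.
    have hnil : Group.IsNilpotent D := by
      refine Subgroup.isNilpotent_of_ker_le_center (Abelianization.of (G := D)) ?_
      rw [Abelianization.ker_of]
      intro z hz
      have hz' : (z : G) ∈ 𝔉.radical.sub G := hDD (by
        rw [← D.map_subtype_commutator]; exact ⟨z, hz, rfl⟩)
      rw [mem_center_iff]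
      intro d
      exact Subtype.ext (mem_centralizer_iff.1 d.2.1 z hz').symm
    exact le_radical this (mem_of_isNilpotent hF hQ hS h1
      (hπ.of_card_dvd D.card_subgroup_dvd_card))
  have all (k : ℕ) : k ≤ n → C ⊓ derivedSeries G k ≤ 𝔉.radical.sub G := fun hk =>
    Nat.decreasingInduction (motive := fun k _ => C ⊓ derivedSeries G k ≤ 𝔉.radical.sub G)
      (fun k _ h => step k h) (by simp [hn]) hk
  simpa using all 0 (Nat.zero_le _)

/-- γ(L) centralizes `S` modulo `R`, and S/R contains its centralizer in G/R; so γ(L) ≤ S. -/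
theorem map_radical_of_preimage_le (hF : 𝔉.IsFittingClass) (hQ : 𝔉.IsQClosed)
    (hS : 𝔉.IsSoluble) (h1 : 𝔉.Mem PUnit.{u + 1}) {G : Type u} [Group G] [Finite G]
    [Group.IsSolvable G] (hπ : IsPiGroup 𝔉.primes G) {L : Subgroup G}
    (hL : 𝔉.radical.preimage (𝔉.radical.sub G) ≤ L) :
    (𝔉.radical.sub L).map L.subtype = 𝔉.radical.sub G := by
  set R := 𝔉.radical.sub G
  set S := 𝔉.radical.preimage R
  have hRS : R ≤ S := 𝔉.radical.le_preimage R
  have hRmem : 𝔉.Mem R := hF.mem_radical h1 G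
  -- `S` is normal in both `L` and `G`, so γ(L) and γ(G) both meet it in γ(S).
  have hinf (x : L) (hxS : (x : G) ∈ S) (hx : x ∈ 𝔉.radical.sub L) : (x : G) ∈ R := by
    have h2 : x ∈ S.subgroupOf L ⊓ 𝔉.radical.sub L := ⟨hxS, hx⟩
    rw [← hF.map_radical_of_normal h1] at h2
    obtain ⟨y, hy, rfl⟩ := h2
    have h3 : ((subgroupOfEquivOfLe hL y : S) : G) ∈ (𝔉.radical.sub S).map S.subtype :=
      ⟨_, (𝔉.radical.mem_sub_iff (subgroupOfEquivOfLe hL)).2 hy, rfl⟩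
    rw [hF.map_radical_of_normal h1] at h3
    exact h3.2
  apply le_antisymm
  · rintro _ ⟨x, hx, rfl⟩
    refine hinf x ?_ hx
    have : Group.IsSolvable (G ⧸ R) := inferInstance
    refine centralizer_radical_le hF hQ hS h1
      (hπ.of_card_dvd (H := G ⧸ R) R.card_quotient_dvd_card) ?_
    rw [mem_centralizer_iff]
    intro y hy
    obtain ⟨y, rfl⟩ := QuotientGroup.mk'_surjective R y
    have hyS : y ∈ S := hy
    let y' : L := ⟨y, hL hyS⟩
    have hc : ((⁅x, y'⁆ : L) : G) ∈ R := by
      refine hinf _ ?_ ?_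
      · have hn : S.Normal := inferInstance
        have := hn.conj_mem _ hyS x
        simpa [commutatorElement_def, y'] using mul_mem this (inv_mem hyS)
      · have := mul_mem hx ((𝔉.radical.normal_sub L).conj_mem _ (inv_mem hx) y')
        simpa [commutatorElement_def, mul_assoc] using this
    have : QuotientGroup.mk' R ⁅(x : G), y⁆ = 1 := (QuotientGroup.eq_one_iff _).2 hc
    rw [map_commutatorElement, commutatorElement_eq_one_iff_mul_comm] at this
    exact this.symm
  · intro x hx
    exact ⟨⟨x, hL (hRS hx)⟩, le_radical (N := R.subgroupOf L) inferInstance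
      (hRmem.of_mulEquiv (subgroupOfEquivOfLe (hRS.trans hL)).symm) hx, rfl⟩

theorem map_series_of_series_succ_le (hF : 𝔉.IsFittingClass) (hQ : 𝔉.IsQClosed)
    (hS : 𝔉.IsSoluble) (h1 : 𝔉.Mem PUnit.{u + 1}) {G : Type u} [Group G] [Finite G]
    [Group.IsSolvable G] (hπ : IsPiGroup 𝔉.primes G) {M : Subgroup G} {j : ℕ}
    (hM : (𝔉.radical.series (j + 1)).sub G ≤ M) :
    ((𝔉.radical.series j).sub M).map M.subtype = (𝔉.radical.series j).sub G := by
  induction j with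
  | zero => exact Subgroup.map_bot _
  | succ j ih =>
    have hmono := 𝔉.radical.series_mono G
    specialize ih ((hmono (Nat.le_succ _)).trans hM)
    set R := (𝔉.radical.series j).sub G
    let q := QuotientGroup.mk' R
    have hq : Function.Surjective q := QuotientGroup.mk'_surjective R
    let g := q.subgroupMap M
    have hgker : g.ker = (𝔉.radical.series j).sub M := by
      ext x
      have : g x = 1 ↔ (x : G) ∈ R := by
        rw [← QuotientGroup.eq_one_iff (N := R)]
        exact Subtype.ext_iff
      rw [MonoidHom.mem_ker, this, ← ih]
      exact ⟨fun ⟨y, hy, hyx⟩ => Subtype.ext hyx ▸ hy, fun h => ⟨x, h, rfl⟩⟩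
    have hover : 𝔉.radical.preimage (𝔉.radical.sub (G ⧸ R)) ≤ M.map q := by
      intro y hy
      obtain ⟨x, rfl⟩ := hq y
      refine ⟨x, hM ?_, rfl⟩
      rw [Functorial.series_succ_sub, Functorial.preimage_eq_comap _
        ((QuotientGroup.mk' (𝔉.radical.sub (G ⧸ R))).comp q)
        ((QuotientGroup.mk'_surjective _).comp hq)]
      · exact hy
      · rw [← MonoidHom.comap_ker, QuotientGroup.ker_mk']
        rfl
    have hrad := map_radical_of_preimage_le hF hQ hS h1
      (hπ.of_card_dvd (H := G ⧸ R) R.card_quotient_dvd_card) hover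
    rw [Functorial.series_succ_sub, Functorial.series_succ_sub,
      Functorial.preimage_eq_comap _ g (q.subgroupMap_surjective M) hgker]
    ext x
    have hx : x ∈ 𝔉.radical.preimage R ↔ q x ∈ 𝔉.radical.sub (G ⧸ R) := Iff.rfl
    constructor
    · rintro ⟨y, hy, rfl⟩
      exact hx.2 (hrad ▸ ⟨g y, hy, rfl⟩)
    · intro h
      have hxM : x ∈ M := (hmono (Nat.le_succ (j + 1))).trans hM h
      have h2 := hx.1 h
      rw [← hrad] at h2
      obtain ⟨z, hz, hzx⟩ := h2
      refine ⟨⟨x, hxM⟩, ?_, rfl⟩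
      have : g ⟨x, hxM⟩ = z := Subtype.ext hzx.symm
      rw [SetLike.mem_coe, mem_comap, this]
      exact hz

theorem map_series_add_le (hQ : 𝔉.IsQClosed) {G : Type u} [Group G] [Finite G] {M : Subgroup G}
    {n m : ℕ} (hM : M ⊔ (𝔉.radical.series m).sub G = ⊤)
    (h : ((𝔉.radical.series n).sub M).map M.subtype ≤ (𝔉.radical.series m).sub G) (k : ℕ) :
    ((𝔉.radical.series (n + k)).sub M).map M.subtype ≤ (𝔉.radical.series (m + k)).sub G := by
  induction k with
  | zero => exact h
  | succ k ih =>
    set R := (𝔉.radical.series (m + k)).sub G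
    have hMR : M ⊔ R = ⊤ := eq_top_iff.2 (hM ▸ sup_le_sup_left
      (𝔉.radical.series_mono G (Nat.le_add_right m k)) M)
    rw [map_le_iff_le_comap] at ih ⊢
    refine hQ.preimage_le_comap ((QuotientGroup.mk' R).comp M.subtype) ?_ ?_
    · intro y
      obtain ⟨x, rfl⟩ := QuotientGroup.mk'_surjective R y
      obtain ⟨a, ha, b, hb, rfl⟩ := mem_sup_of_normal_right.1 (hMR ▸ mem_top x)
      refine ⟨⟨a, ha⟩, ?_⟩
      have : QuotientGroup.mk' R b = 1 := (QuotientGroup.eq_one_iff b).2 hb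
      rw [map_mul, this, mul_one]
      rfl
    · rwa [← MonoidHom.comap_ker, QuotientGroup.ker_mk']

theorem exists_series_eq_top (hF : 𝔉.IsFittingClass) (hQ : 𝔉.IsQClosed)
    (hS : 𝔉.IsSoluble) (h1 : 𝔉.Mem PUnit.{u + 1}) {G : Type u} [Group G] [Finite G]
    [Group.IsSolvable G] (hπ : IsPiGroup 𝔉.primes G) {i : ℕ}
    (hi : (𝔉.radical.series (i + 1)).sub G = (𝔉.radical.series i).sub G) :
    (𝔉.radical.series i).sub G = ⊤ := by
  set R := (𝔉.radical.series i).sub G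
  have hbot : 𝔉.radical.sub (G ⧸ R) = ⊥ := by
    refine eq_bot_iff.2 fun y hy => ?_
    obtain ⟨x, rfl⟩ := QuotientGroup.mk'_surjective R y
    have hx : x ∈ R := hi ▸ (hy : x ∈ 𝔉.radical.preimage R)
    exact mem_bot.2 ((QuotientGroup.eq_one_iff x).2 hx)
  have hle := centralizer_radical_le hF hQ hS h1
    (hπ.of_card_dvd (H := G ⧸ R) R.card_quotient_dvd_card)
  rw [hbot] at hle
  refine eq_top_iff.2 fun x _ => ?_
  have hx : QuotientGroup.mk' R x ∈ (⊥ : Subgroup (G ⧸ R)) :=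
    hle (mem_centralizer_iff.2 (by simp))
  exact (QuotientGroup.eq_one_iff x).1 (mem_bot.1 hx)

theorem exists_isLeast_series_eq_top (hF : 𝔉.IsFittingClass) (hQ : 𝔉.IsQClosed)
    (hS : 𝔉.IsSoluble) (h1 : 𝔉.Mem PUnit.{u + 1}) {G : Type u} [Group G] [Finite G]
    [Group.IsSolvable G] (hπ : IsPiGroup 𝔉.primes G) :
    ∃ n, IsLeast {h : ℕ | (𝔉.radical.series h).sub G = ⊤} n := by
  obtain ⟨i, hi⟩ := WellFoundedGT.monotone_chain_condition
    (⟨fun i => (𝔉.radical.series i).sub G, 𝔉.radical.series_mono G⟩ : ℕ →o Subgroup G)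
  exact ⟨_, isLeast_csInf ⟨i, exists_series_eq_top hF hQ hS h1 hπ (hi (i + 1) i.le_succ).symm⟩⟩

theorem series_add_two_eq_top (hF : 𝔉.IsFittingClass) (hQ : 𝔉.IsQClosed)
    (hS : 𝔉.IsSoluble) (h1 : 𝔉.Mem PUnit.{u + 1}) {G : Type u} [Group G] [Finite G]
    [Group.IsSolvable G] (hπ : IsPiGroup 𝔉.primes G) {M : Subgroup G} (hM : IsCoatom M) {b : ℕ}
    (hb : (𝔉.radical.series b).sub M = ⊤) : (𝔉.radical.series (b + 2)).sub G = ⊤ := by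
  have hmono := 𝔉.radical.series_mono G
  -- the series of `G` leaves `M` at some step `n + 2 ≤ b + 2`
  have hleave : ¬ (𝔉.radical.series (b + 2)).sub G ≤ M := by
    intro hle
    -- Otherwise γ₍b₎(G) = M ≥ γ₍b+1₎(G): the series would stall at a proper subgroup.
    have hle1 : (𝔉.radical.series (b + 1)).sub G ≤ M := (hmono (Nat.le_succ _)).trans hle
    have hMb := map_series_of_series_succ_le hF hQ hS h1 hπ hle1
    rw [hb, ← MonoidHom.range_eq_map, range_subtype] at hMb
    refine hM.1 (hMb.trans (exists_series_eq_top hF hQ hS h1 hπ ?_))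
    exact le_antisymm (hMb ▸ hle1) (hmono (Nat.le_succ _))
  obtain ⟨n, hn, hnb⟩ : ∃ n, (¬ (𝔉.radical.series (n + 2)).sub G ≤ M ∧
      ∀ m < n, (𝔉.radical.series (m + 2)).sub G ≤ M) ∧ n ≤ b := by
    classical
    have hex : ∃ n, ¬ (𝔉.radical.series (n + 2)).sub G ≤ M := ⟨b, hleave⟩
    exact ⟨Nat.find hex, ⟨Nat.find_spec hex, fun m hm => not_not.1 (Nat.find_min hex hm)⟩,
      Nat.find_min' hex hleave⟩
  have hbase : ((𝔉.radical.series n).sub M).map M.subtype ≤ (𝔉.radical.series (n + 2)).sub G := by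
    cases n with
    -- Here γ₍₁₎(G) may already lie outside `M`; γ₍₀₎(M) = 1 suffices.
    | zero => exact (Subgroup.map_bot M.subtype).trans_le bot_le
    | succ n =>
      rw [map_series_of_series_succ_le hF hQ hS h1 hπ (hn.2 n n.lt_succ_self)]
      exact hmono (by lia)
  have htop : M ⊔ (𝔉.radical.series (n + 2)).sub G = ⊤ :=
    hM.2 _ (lt_of_le_of_ne le_sup_left fun h => hn.1 (h ▸ le_sup_right))
  have hfin := map_series_add_le hQ htop hbase (b - n)
  rw [show n + (b - n) = b by lia, show n + 2 + (b - n) = b + 2 by lia, hb,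
    ← MonoidHom.range_eq_map, range_subtype] at hfin
  rw [eq_top_iff, ← htop]
  exact sup_le hfin (hmono (by lia))

end GroupClass

theorem mainTheorem5 (𝔉 : GroupClass.{u}) (hF : 𝔉.IsFittingClass) (hQ : 𝔉.IsQClosed)
    (hS : 𝔉.IsSoluble) (G : Type u) [Group G] [Finite G] (hG : Group.IsSolvable G)
    (hπ : IsPiGroup 𝔉.primes G) (M : Subgroup G) (hM : IsCoatom M) :
    ∃ a b : ℕ, 𝔉.radical.length G = a ∧ 𝔉.radical.length M = b ∧ (a : ℤ) - (b : ℤ) ≤ 2 := by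
  -- The empty class is not excluded, but a proper subgroup makes `G` nontrivial, so `π` is
  -- nonempty.
  have h1 : 𝔉.Mem PUnit.{u + 1} := by
    have hne : Nat.card G ≠ 1 := fun h => by
      have := (Nat.card_eq_one_iff_unique.1 h).1
      exact hM.1 (Subsingleton.elim _ _)
    obtain ⟨p, hp, hpG⟩ := Nat.exists_prime_and_dvd hne
    obtain ⟨_, H, _, _, hH, _⟩ := hπ p hp hpG
    exact GroupClass.mem_punit_of_mem hQ hH
  obtain ⟨a, ha⟩ := GroupClass.exists_isLeast_series_eq_top hF hQ hS h1 hπ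
  obtain ⟨b, hb⟩ := GroupClass.exists_isLeast_series_eq_top hF hQ hS h1
    (hπ.of_card_dvd (H := M) M.card_subgroup_dvd_card)
  refine ⟨a, b, 𝔉.radical.length_eq_of_isLeast ha, 𝔉.radical.length_eq_of_isLeast hb, ?_⟩
  have : a ≤ b + 2 := ha.2 (GroupClass.series_add_two_eq_top hF hQ hS h1 hπ hM hb.1)
  lia
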